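/- Let $p$ be a prime, $F$ a non-archimedean local field with residue characteristic $p$ (of any characteristic), $\mathcal O$ its ring of integers, $\varpi$ a uniformizer, and $k$ an algebraically closed field of characteristic $p$. Let $G=\mathrm{GL}_2(F)$, $K=\mathrm{GL}_2(\mathcal O)$, and let $Z$ be the centre of $G$. Let $\pi$ be a smooth representation of $G$ over $k$ with a central character, finitely generated as a $k[G]$-module. Let $\mathcal W(\pi)$ be the set of finite-dimensional $KZ$-stable subspaces $W\subset\pi$ that generate $\pi$ as a $k[G]$-module. For $W\in\mathcal W(\pi)$, let $\mathrm{c\text{-}Ind}_{KZ}^G W$ be the space of locally constant functions $f:G\to W$ with compact support modulo $KZ$ such that $f(hg)=h\cdot f(g)$ for $h\in KZ$, $g\in G$, on which $G$ acts by $(g'f)(g)=f(gg')$. For $g\in G$ and $w\in W$ let $[g,w]$ be its element supported on $KZg^{-1}$ with value $w$ at $g^{-1}$. Let $R(W,\pi)$ be the kernel of the surjective $G$-equivariant map $\mathrm{c\text{-}Ind}_{KZ}^G W\to\pi$, $[g,w]\mapsto g w$. This map is called a finite presentation of $\pi$ if $R(W,\pi)$ is finitely generated as a $k[G]$-module; it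 is called a standard presentation of $\pi$ if $R(W,\pi)$ is generated as a $k[G]$-module by the elements $$[\alpha,x]-[1,\alpha x],\qquad x\in W\cap\alpha^{-1}W,\qquad \alpha=\begin{pmatrix}\varpi&0\\0&1\end{pmatrix}.$$ We say that $\pi$ admits a finite (resp. standard) presentation if for some $W\in\mathcal W(\pi)$ the map $\mathrm{c\text{-}Ind}_{KZ}^G W\to\pi$ is a finite (resp. standard) presentation of $\pi$. Then: 1. $\pi$ admits a finite presentation if and only if $\pi$ admits a standard presentation. 2. $\pi$ admits a finite presentation if and only if, for every $W\in\mathcal W(\pi)$, the map $\mathrm{c\text{-}Ind}_{KZ}^G W\to\pi$ is a finite presentation. -/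

import Mathlib

open scoped ValuativeRel Pointwise

noncomputable section

namespace ModPRep

section General

variable {k G V : Type*} [Field k] [Group G] [AddCommGroup V] [Module k V]

/-- The subspace `⟨G · S⟩` spanned by the `G`-translates of the elements of `S`, i.e. the
`k[G]`-submodule generated by `S`. -/
def gspan (ρ : Representation k G V) (S : Set V) : Submodule k V :=
  Submodule.span k {v | ∃ g : G, ∃ s ∈ S, v = ρ g s}

/-- The subspace `R` is finitely generated as a `k[G]`-submodule. -/
def IsFinGen (ρ : Representation k G V) (R : Submodule k V) : Prop :=
  ∃ S : Set V, S.Finite ∧ gspan ρ S = R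

/-- The centre of `G` acts through a character. -/
def HasCentralCharacter (ρ : Representation k G V) : Prop :=
  ∃ χ : Subgroup.center G →* kˣ, ∀ (z : Subgroup.center G) (v : V),
    ρ (z : G) v = (χ z : k) • v

/-- Restriction of a representation to a subgroup. -/
abbrev res (ρ : Representation k G V) (H : Subgroup G) : Representation k H V :=
  ρ.comp H.subtype

variable [TopologicalSpace G]

/-- A representation is smooth if every vector is fixed by an open subgroup. -/
class IsSmooth (ρ : Representation k G V) : Prop where
  exists_open : ∀ v : V, ∃ U : Subgroup G, IsOpen (U : Set G) ∧ ∀ g ∈ U, ρ g v = v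

instance isSmooth_res (ρ : Representation k G V) [IsSmooth ρ] (H : Subgroup G) :
    IsSmooth (res ρ H) where
  exists_open v := by
    obtain ⟨U, hU, h⟩ := IsSmooth.exists_open (ρ := ρ) v
    exact ⟨U.subgroupOf H, hU.preimage continuous_subtype_val, fun g hg => h g hg⟩

instance isSmooth_sub (ρ : Representation k G V) [IsSmooth ρ] (W : Subrepresentation ρ) :
    IsSmooth W.toRepresentation where
  exists_open v := by
    obtain ⟨U, hU, h⟩ := IsSmooth.exists_open (ρ := ρ) (v : V)
    exact ⟨U, hU, fun g hg => Subtype.ext (h g hg)⟩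

end General

section CompactInduction

variable {k G M : Type*} [Field k] [Group G] [TopologicalSpace G] [IsTopologicalGroup G]
  [AddCommGroup M] [Module k M] {H : Subgroup G}

/-- The space of the compact induction of the representation `σ` of `H`: locally constant
functions `f : G → M` with compact support modulo `H` such that `f (h g) = h · f g`. -/
def cInd (σ : Representation k H M) : Submodule k (G → M) where
  carrier := {f | IsLocallyConstant f ∧
    (∃ C : Set G, IsCompact C ∧ Function.support f ⊆ (H : Set G) * C) ∧
    ∀ (h : H) (g : G), f (h * g) = σ h (f g)}
  zero_mem' := ⟨IsLocallyConstant.const 0, ⟨∅, isCompact_empty, by simp⟩, by simp⟩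
  add_mem' := by
    rintro f f' ⟨h1, ⟨C, hC, hs⟩, h3⟩ ⟨h1', ⟨C', hC', hs'⟩, h3'⟩
    refine ⟨h1.add h1', ⟨C ∪ C', hC.union hC', ?_⟩, fun h g => by simp [h3, h3']⟩
    refine (Function.support_add f f').trans ?_
    rw [Set.mul_union]
    exact Set.union_subset_union hs hs'
  smul_mem' := by
    rintro c f ⟨h1, ⟨C, hC, hs⟩, h3⟩
    exact ⟨h1.comp (c • ·), ⟨C, hC, (Function.support_const_smul_subset c f).trans hs⟩,
      fun h g => by simp [h3]⟩

/-- The action `(g' · f) g = f (g g')` of `G` on the compact induction. -/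
def cIndRep (σ : Representation k H M) : Representation k G (cInd σ) where
  toFun g' :=
    { toFun := fun f => ⟨fun g => f.1 (g * g'), by
        obtain ⟨f, h1, ⟨C, hC, hs⟩, h3⟩ := f
        refine ⟨h1.comp_continuous (continuous_mul_const g'),
          ⟨C * {g'⁻¹}, hC.mul isCompact_singleton, ?_⟩, fun h g => ?_⟩
        · intro g hg
          obtain ⟨h, hh, c, hc, e⟩ := hs (show g * g' ∈ Function.support f from hg)
          exact ⟨h, hh, c * g'⁻¹, Set.mul_mem_mul hc rfl, by
            change h * (c * g'⁻¹) = g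
            rw [← mul_assoc, show h * c = g * g' from e, mul_inv_cancel_right]⟩
        · simpa [mul_assoc] using h3 h (g * g')⟩
      map_add' := fun _ _ => rfl
      map_smul' := fun _ _ => rfl }
  map_one' := by ext f; simp
  map_mul' a b := by ext f; simp [mul_assoc]

open Classical in
/-- The function `[g, v]` with support in `H g⁻¹` and value `v` at `g⁻¹`, as an element of the
compact induction of a smooth representation of an open subgroup. -/
def bracket (hH : IsOpen (H : Set G)) (σ : Representation k H M) [IsSmooth σ] (g : G) (v : M) :
    cInd σ :=
  ⟨fun x => if hx : x * g ∈ H then σ ⟨x * g, hx⟩ v else 0, by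
    have key : ∀ (h : H) (x : G),
        (if hx : (h : G) * x * g ∈ H then σ ⟨h * x * g, hx⟩ v else 0) =
          σ h (if hx : x * g ∈ H then σ ⟨x * g, hx⟩ v else 0) := by
      intro h x
      by_cases hx : x * g ∈ H
      · have hx' : (h : G) * x * g ∈ H := by rw [mul_assoc]; exact H.mul_mem h.2 hx
        rw [dif_pos hx, dif_pos hx', ← Module.End.mul_apply, ← map_mul]
        exact congrArg (fun a : H => σ a v) (Subtype.ext (mul_assoc (h : G) x g))
      · have hx' : (h : G) * x * g ∉ H := by
          rw [mul_assoc, H.mul_mem_cancel_left h.2]; exact hx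
        rw [dif_neg hx, dif_neg hx', map_zero]
    refine ⟨?_, ⟨{g⁻¹}, isCompact_singleton, ?_⟩, key⟩
    · rw [IsLocallyConstant.iff_exists_open]
      intro x
      obtain ⟨U, hU, hfix⟩ := IsSmooth.exists_open (ρ := σ)
        (if hx : x * g ∈ H then σ ⟨x * g, hx⟩ v else 0)
      refine ⟨(fun y => y * x⁻¹) ⁻¹' (Subtype.val '' (U : Set H)),
        (hH.isOpenMap_subtype_val _ hU).preimage (continuous_mul_const _), ?_, ?_⟩
      · exact ⟨1, U.one_mem, by simp⟩
      · rintro y ⟨u, hu, e⟩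
        have hy : y = (u : G) * x := by
          have e' : (u : G) = y * x⁻¹ := e
          rw [e']; group
        rw [hy]
        exact (key u x).trans (hfix u hu)
    · intro x hx
      have hxH : x * g ∈ H := by
        by_contra hn
        exact hx (dif_neg hn)
      exact ⟨x * g, hxH, g⁻¹, rfl, by simp⟩⟩

variable {V : Type*} [AddCommGroup V] [Module k V]

theorem frobenius_support_finite (hH : IsOpen (H : Set G)) (ρ : Representation k G V)
    (W : Subrepresentation (res ρ H)) (f : cInd W.toRepresentation) :
    (Function.support fun q : G ⧸ H => ρ q.out ((f.1 q.out⁻¹ : W.toSubmodule) : V)).Finite := by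
  obtain ⟨f, h1, ⟨C, hC, hs⟩, h3⟩ := f
  have hd : DiscreteTopology (G ⧸ H) := QuotientGroup.discreteTopology hH
  have hfin : ((fun g : G => (g : G ⧸ H)) '' C⁻¹).Finite :=
    (hC.inv.image QuotientGroup.continuous_mk).finite_of_discrete
  refine hfin.subset fun q hq => ?_
  have hq' : q.out⁻¹ ∈ Function.support f := by
    intro h0
    exact hq (by simp [h0])
  obtain ⟨h, hh, c, hc, e⟩ := hs hq'
  refine ⟨c⁻¹, Set.inv_mem_inv.mpr hc, ?_⟩
  have e' : q.out = c⁻¹ * h⁻¹ := by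
    have : (h * c)⁻¹ = q.out := by
      rw [show h * c = q.out⁻¹ from e, inv_inv]
    rw [← this, mul_inv_rev]
  rw [← QuotientGroup.out_eq' q, e']
  exact (QuotientGroup.mk_mul_of_mem _ (H.inv_mem hh)).symm

/-- For an `H`-stable subspace `W` of `ρ`, the `G`-morphism from the compact induction of `W` to
`ρ` given by Frobenius reciprocity, i.e. `[g, w] ↦ g w`, written as
`f ↦ ∑ g · f(g⁻¹)` over `g ∈ G / H` (the summand depends only on the class of `g`). -/
def frobenius (hH : IsOpen (H : Set G)) (ρ : Representation k G V)
    (W : Subrepresentation (res ρ H)) : cInd W.toRepresentation →ₗ[k] V where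
  toFun f := ∑ᶠ q : G ⧸ H, ρ q.out ((f.1 q.out⁻¹ : W.toSubmodule) : V)
  map_add' f f' := by
    rw [← finsum_add_distrib (frobenius_support_finite hH ρ W f)
      (frobenius_support_finite hH ρ W f')]
    simp
  map_smul' c f := by
    rw [RingHom.id_apply, smul_finsum' c (frobenius_support_finite hH ρ W f)]
    simp

end CompactInduction

section GL2

variable (F : Type*) [Field F] [ValuativeRel F] [TopologicalSpace F] [IsNonarchimedeanLocalField F]

/-- The maximal compact subgroup `K = GL₂(𝒪)` of `G = GL₂(F)`. -/
def K : Subgroup (GL (Fin 2) F) :=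
  (Matrix.GeneralLinearGroup.map (n := Fin 2) (algebraMap 𝒪[F] F)).range

/-- The subgroup `KZ`, with `Z` the centre of `GL₂(F)`. -/
def KZ : Subgroup (GL (Fin 2) F) :=
  K F ⊔ Subgroup.center (GL (Fin 2) F)

theorem isOpen_K : IsOpen (K F : Set (GL (Fin 2) F)) := by
  have hO : IsOpen (𝒪[F] : Set F) := Valuation.isOpen_integer
  have hS : (K F : Set (GL (Fin 2) F)) =
      {g | (∀ i j, g.1 i j ∈ 𝒪[F]) ∧ ∀ i j, g⁻¹.1 i j ∈ 𝒪[F]} := by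
    ext g
    constructor
    · rintro ⟨a, rfl⟩
      exact ⟨fun i j => (a.1 i j).2, fun i j => by
        rw [← map_inv]; exact (a⁻¹.1 i j).2⟩
    · rintro ⟨h1, h2⟩
      have inj : Function.Injective
          (RingHom.mapMatrix (m := Fin 2) (algebraMap 𝒪[F] F)) :=
        Matrix.map_injective Subtype.val_injective
      let A : Matrix (Fin 2) (Fin 2) 𝒪[F] := Matrix.of fun i j => ⟨g.1 i j, h1 i j⟩
      let B : Matrix (Fin 2) (Fin 2) 𝒪[F] := Matrix.of fun i j => ⟨g⁻¹.1 i j, h2 i j⟩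
      have hA : RingHom.mapMatrix (algebraMap 𝒪[F] F) A = g.1 := by ext i j; rfl
      have hB : RingHom.mapMatrix (algebraMap 𝒪[F] F) B = g⁻¹.1 := by ext i j; rfl
      refine ⟨⟨A, B, inj ?_, inj ?_⟩, Units.ext hA⟩
      · rw [map_mul, hA, hB, map_one]; exact g.mul_inv
      · rw [map_mul, hA, hB, map_one]; exact g.inv_mul
  rw [hS]
  have c1 : Continuous fun g : GL (Fin 2) F => g.1 := Units.continuous_val
  have c2 : Continuous fun g : GL (Fin 2) F => g⁻¹.1 := Units.continuous_coe_inv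
  simp only [Set.ofPred_and, Set.ofPred_forall]
  refine IsOpen.inter ?_ ?_
  · exact isOpen_iInter_of_finite fun i => isOpen_iInter_of_finite fun j =>
      hO.preimage (c1.matrix_elem i j)
  · exact isOpen_iInter_of_finite fun i => isOpen_iInter_of_finite fun j =>
      hO.preimage (c2.matrix_elem i j)

theorem isOpen_KZ : IsOpen (KZ F : Set (GL (Fin 2) F)) :=
  Subgroup.isOpen_mono le_sup_left (isOpen_K F)

variable {F}

/-- The matrix `diag(ϖ, 1)` of `GL₂(F)`, for `ϖ` a uniformizer. -/
def diagUnif (ϖ : 𝒪[F]) (hϖ : Irreducible ϖ) : GL (Fin 2) F :=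
  Matrix.GeneralLinearGroup.mkOfDetNeZero !![(ϖ : F), 0; 0, 1] (by
    simpa [Matrix.det_fin_two] using hϖ.ne_zero)

variable {k V : Type*} [Field k] [AddCommGroup V] [Module k V]

/-- The set `𝒲(π)` of finite-dimensional `KZ`-stable subspaces generating `π` over `k[G]`. -/
def genSubspaces (ρ : Representation k (GL (Fin 2) F) V) :
    Set (Subrepresentation (res ρ (KZ F))) :=
  {W | FiniteDimensional k W.toSubmodule ∧ gspan ρ (W.toSubmodule : Set V) = ⊤}

/-- The kernel `R(W, π)` of the morphism from the compact induction of `W` to `π`. -/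
def relations (ρ : Representation k (GL (Fin 2) F) V) (W : Subrepresentation (res ρ (KZ F))) :
    Submodule k (cInd W.toRepresentation) :=
  LinearMap.ker (frobenius (isOpen_KZ F) ρ W)

/-- The set `R⁽⁰⁾(W, π)` of the elements `[α, x] - [1, α x]`, with `α = diag(ϖ, 1)` and
`x ∈ W ∩ α⁻¹ W`, i.e. both `x` and `y = α x` in `W`. -/
def elementaryRelations (ϖ : 𝒪[F]) (hϖ : Irreducible ϖ)
    (ρ : Representation k (GL (Fin 2) F) V) [IsSmooth ρ]
    (W : Subrepresentation (res ρ (KZ F))) : Set (cInd W.toRepresentation) :=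
  {f | ∃ x y : W.toSubmodule, ρ (diagUnif ϖ hϖ) (x : V) = y ∧
    f = bracket (isOpen_KZ F) W.toRepresentation (diagUnif ϖ hϖ) x -
      bracket (isOpen_KZ F) W.toRepresentation 1 y}

/-- The presentation of `π` attached to `W` is finite: `R(W, π)` is finitely generated over
`k[G]`. -/
def IsFinitePresentation (ρ : Representation k (GL (Fin 2) F) V)
    (W : Subrepresentation (res ρ (KZ F))) : Prop :=
  IsFinGen (cIndRep W.toRepresentation) (relations ρ W)

/-- The presentation of `π` attached to `W` is standard: `R(W, π)` is generated over `k[G]` by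
`R⁽⁰⁾(W, π)`. -/
def IsStandardPresentation (ϖ : 𝒪[F]) (hϖ : Irreducible ϖ)
    (ρ : Representation k (GL (Fin 2) F) V) [IsSmooth ρ]
    (W : Subrepresentation (res ρ (KZ F))) : Prop :=
  gspan (cIndRep W.toRepresentation) (elementaryRelations ϖ hϖ ρ W) = relations ρ W

/-- `π` admits a finite presentation. -/
def AdmitsFinitePresentation (ρ : Representation k (GL (Fin 2) F) V) : Prop :=
  ∃ W ∈ genSubspaces ρ, IsFinitePresentation ρ W

/-- `π` admits a standard presentation. -/
def AdmitsStandardPresentation (ϖ : 𝒪[F]) (hϖ : Irreducible ϖ)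
    (ρ : Representation k (GL (Fin 2) F) V) [IsSmooth ρ] : Prop :=
  ∃ W ∈ genSubspaces ρ, IsStandardPresentation ϖ hϖ ρ W

end GL2

end ModPRep

end

/-! Write `H = KZ`, `α = diag(ϖ, 1)`. Two facts drive the proof. Smooth representations with central
character are locally finite over `KZ`, since `K` is compact (`isLocallyFinite_KZ`); this covers
both `π` and the compact inductions. And `KZ` and `α` generate `G` (`KZ_sup_zpowers_diagUnif`).

Independence of `W` (`isFinGen_ker_frobenius`) is a Schanuel-type comparison. Lifting `W` linearly
along `c-Ind W' → π` gives a map `Φ : c-Ind W → c-Ind W'` over `π`. The lift need not be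
`H`-equivariant, but its defects span a finite-dimensional space by local finiteness. Then `R(W',
π)` is generated by these defects, the image under `Φ` of generators of `R(W, π)`, and the
finite-dimensional space of differences between `[1, w']` and its image under a round trip through
`c-Ind W`.

A standard presentation is finite because its relations lie in `[α, W] + [1, W]`. Conversely
(`exists_gspan_edgeRelations_eq_ker`), replace `W` by the span `Wₙ` of its translates over the ball
of radius `n` in the graph on `G / H`, with `n` so large that finitely many generators of `R(W, π)`
are supported in that ball. Edge relations for `Wₙ` move `[ag, w]` to `[a, gw]` for `w ∈ W` and `g`
in the ball. Hence `c-Ind W` surjects onto `c-Ind Wₙ` modulo edge relations, and each generator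
collapses to `[1, 0] = 0`. -/

noncomputable section

namespace ModPRep

/-! ### Submodules generated under a group action -/

section GSpan

variable {k G V : Type*} [Field k] [Group G] [AddCommGroup V] [Module k V]
  {ρ : Representation k G V}

theorem map_mem_span {X : Set V} {T : V →ₗ[k] V} (h : ∀ x ∈ X, T x ∈ Submodule.span k X) {v : V}
    (hv : v ∈ Submodule.span k X) : T v ∈ Submodule.span k X :=
  (Submodule.span_le (p := (Submodule.span k X).comap T)).2 h hv

theorem subset_gspan (S : Set V) : S ⊆ gspan ρ S := fun s hs =>
  Submodule.subset_span ⟨1, s, hs, by simp⟩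

theorem apply_mem_gspan {S : Set V} (g : G) {v : V} (hv : v ∈ gspan ρ S) :
    ρ g v ∈ gspan ρ S := by
  refine map_mem_span ?_ hv
  rintro _ ⟨a, s, hs, rfl⟩
  exact Submodule.subset_span ⟨g * a, s, hs, by simp⟩

theorem gspan_le {S : Set V} {N : Submodule k V} (hN : ∀ (g : G), ∀ v ∈ N, ρ g v ∈ N)
    (h : S ⊆ N) : gspan ρ S ≤ N := by
  refine Submodule.span_le.2 ?_
  rintro _ ⟨g, s, hs, rfl⟩
  exact hN g s (h hs)

theorem gspan_mono {S T : Set V} (h : S ⊆ T) : gspan ρ S ≤ gspan ρ T :=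
  gspan_le (fun g _ hv => apply_mem_gspan g hv) (h.trans (subset_gspan T))

theorem gspan_span (S : Set V) : gspan ρ (Submodule.span k S : Set V) = gspan ρ S :=
  le_antisymm
    (gspan_le (fun g _ hv => apply_mem_gspan g hv) (Submodule.span_le.2 (subset_gspan S)))
    (gspan_mono Submodule.subset_span)

/-- A `k[G]`-submodule generated by a subset of a finite-dimensional subspace is finitely
generated. -/
theorem isFinGen_gspan_of_subset {S : Set V} {D : Submodule k V} [FiniteDimensional k D]
    (h : S ⊆ D) : IsFinGen ρ (gspan ρ S) := by
  have : FiniteDimensional k (Submodule.span k S) :=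
    Submodule.finiteDimensional_of_le (Submodule.span_le.2 h)
  obtain ⟨T, hT, e⟩ := Submodule.fg_def.1 ((Submodule.fg_iff_finiteDimensional _).2 this)
  exact ⟨T, hT, by rw [← gspan_span T, e, gspan_span]⟩

end GSpan

/-! ### Brackets and maps out of compact induction -/

section CompactInduction

variable {k G M : Type*} [Field k] [Group G] [TopologicalSpace G] [IsTopologicalGroup G]
  [AddCommGroup M] [Module k M] {H : Subgroup G}

theorem bracket_apply_of_mem (hH : IsOpen (H : Set G)) (σ : Representation k H M) [IsSmooth σ]
    {g x : G} (hx : x * g ∈ H) (v : M) : (bracket hH σ g v).1 x = σ ⟨x * g, hx⟩ v :=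
  dif_pos hx

theorem bracket_apply_of_notMem (hH : IsOpen (H : Set G)) (σ : Representation k H M) [IsSmooth σ]
    {g x : G} (hx : x * g ∉ H) (v : M) : (bracket hH σ g v).1 x = 0 :=
  dif_neg hx

/-- The bracket `[g, v]` as a linear map in `v`. -/
def bracketₗ (hH : IsOpen (H : Set G)) (σ : Representation k H M) [IsSmooth σ] (g : G) :
    M →ₗ[k] cInd σ where
  toFun := bracket hH σ g
  map_add' v w := by
    ext x
    by_cases hx : x * g ∈ H
    · simp [bracket_apply_of_mem hH σ hx]
    · simp [bracket_apply_of_notMem hH σ hx]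
  map_smul' c v := by
    ext x
    by_cases hx : x * g ∈ H
    · simp [bracket_apply_of_mem hH σ hx]
    · simp [bracket_apply_of_notMem hH σ hx]

@[simp]
theorem bracketₗ_apply (hH : IsOpen (H : Set G)) (σ : Representation k H M) [IsSmooth σ] (g : G)
    (v : M) : bracketₗ hH σ g v = bracket hH σ g v := rfl

theorem cIndRep_bracket (hH : IsOpen (H : Set G)) (σ : Representation k H M) [IsSmooth σ]
    (a g : G) (v : M) : cIndRep σ a (bracket hH σ g v) = bracket hH σ (a * g) v := by
  ext x
  change (bracket hH σ g v).1 (x * a) = _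
  by_cases hx : x * a * g ∈ H
  · have hx' : x * (a * g) ∈ H := by rwa [← mul_assoc]
    rw [bracket_apply_of_mem hH σ hx, bracket_apply_of_mem hH σ hx']
    exact congrArg (fun b : H => σ b v) (Subtype.ext (mul_assoc x a g))
  · have hx' : x * (a * g) ∉ H := by rwa [← mul_assoc]
    rw [bracket_apply_of_notMem hH σ hx, bracket_apply_of_notMem hH σ hx']

theorem bracket_mul_mem (hH : IsOpen (H : Set G)) (σ : Representation k H M) [IsSmooth σ]
    (g : G) (h : H) (v : M) : bracket hH σ (g * h) v = bracket hH σ g (σ h v) := by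
  ext x
  by_cases hx : x * g ∈ H
  · have hx' : x * (g * h) ∈ H := by rw [← mul_assoc]; exact H.mul_mem hx h.2
    rw [bracket_apply_of_mem hH σ hx, bracket_apply_of_mem hH σ hx', ← Module.End.mul_apply,
      ← map_mul]
    exact congrArg (fun b : H => σ b v) (Subtype.ext (mul_assoc x g h).symm)
  · have hx' : x * (g * h) ∉ H := by rwa [← mul_assoc, H.mul_mem_cancel_right h.2]
    rw [bracket_apply_of_notMem hH σ hx, bracket_apply_of_notMem hH σ hx']

theorem support_out_finite (hH : IsOpen (H : Set G)) {σ : Representation k H M} (f : cInd σ) :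
    (Function.support fun q : G ⧸ H => f.1 q.out⁻¹).Finite := by
  obtain ⟨f, h1, ⟨C, hC, hs⟩, h3⟩ := f
  have hd : DiscreteTopology (G ⧸ H) := QuotientGroup.discreteTopology hH
  have hfin : ((fun g : G => (g : G ⧸ H)) '' C⁻¹).Finite :=
    (hC.inv.image QuotientGroup.continuous_mk).finite_of_discrete
  refine hfin.subset fun q hq => ?_
  obtain ⟨h, hh, c, hc, e⟩ := hs (show q.out⁻¹ ∈ Function.support f from hq)
  refine ⟨c⁻¹, Set.inv_mem_inv.mpr hc, ?_⟩
  have e' : q.out = c⁻¹ * h⁻¹ := by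
    rw [← mul_inv_rev, show h * c = q.out⁻¹ from e, inv_inv]
  rw [← QuotientGroup.out_eq' q, e']
  exact (QuotientGroup.mk_mul_of_mem _ (H.inv_mem hh)).symm

/-- By equivariance `f` is determined by one value on each coset `H x`. The supports of the brackets
are such cosets, so only the class of `x⁻¹` contributes at `x`. -/
theorem eq_sum_bracket (hH : IsOpen (H : Set G)) (σ : Representation k H M) [IsSmooth σ]
    (f : cInd σ) :
    f = ∑ q ∈ (support_out_finite hH f).toFinset, bracket hH σ q.out (f.1 q.out⁻¹) := by
  classical
  ext x
  have hx : x * ((x⁻¹ : G) : G ⧸ H).out ∈ H := by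
    have := QuotientGroup.eq.1 (QuotientGroup.out_eq' ((x⁻¹ : G) : G ⧸ H)).symm
    rwa [inv_inv] at this
  rw [AddSubmonoidClass.coe_finsetSum, Finset.sum_apply,
    Finset.sum_eq_single ((x⁻¹ : G) : G ⧸ H)]
  · rw [bracket_apply_of_mem hH σ hx, ← f.2.2.2]
    simp
  · intro q _ hq
    refine bracket_apply_of_notMem hH σ (fun hm => hq ?_) _
    rw [← QuotientGroup.out_eq' q, eq_comm]
    exact QuotientGroup.eq.2 (by rwa [inv_inv])
  · intro hq
    rw [Set.Finite.mem_toFinset, Function.notMem_support] at hq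
    rw [hq]
    exact congrArg (fun y : cInd σ => y.1 x) ((bracketₗ hH σ _).map_zero)

/-- The brackets span the compact induction. -/
@[elab_as_elim]
theorem cInd_induction (hH : IsOpen (H : Set G)) (σ : Representation k H M) [IsSmooth σ]
    {P : cInd σ → Prop} (f : cInd σ) (zero : P 0) (add : ∀ a b, P a → P b → P (a + b))
    (bracket : ∀ g v, P (bracket hH σ g v)) : P f := by
  rw [eq_sum_bracket hH σ f]
  exact Finset.sum_induction _ P add zero fun q _ => bracket _ _

theorem isSmooth_cIndRep (hH : IsOpen (H : Set G)) (σ : Representation k H M) [IsSmooth σ] :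
    IsSmooth (cIndRep σ) where
  exists_open f := by
    induction f using cInd_induction hH σ with
    | zero => exact ⟨⊤, isOpen_univ, by simp⟩
    | add a b ha hb =>
      obtain ⟨U, hU, h⟩ := ha
      obtain ⟨U', hU', h'⟩ := hb
      exact ⟨U ⊓ U', hU.inter hU', fun g hg => by rw [map_add, h g hg.1, h' g hg.2]⟩
    | bracket g v =>
      obtain ⟨U, hU, h⟩ := IsSmooth.exists_open (ρ := σ) v
      -- This is `g U g⁻¹`, which fixes `[g, v]` when `U` fixes `v`.
      refine ⟨(U.map H.subtype).comap (MulAut.conj g⁻¹).toMonoidHom, ?_, ?_⟩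
      · refine (hH.isOpenMap_subtype_val _ hU).preimage (f := fun x => g⁻¹ * x * g⁻¹⁻¹) ?_
        fun_prop
      · rintro x ⟨u, hu, e⟩
        have e' : x * g = g * u := by
          have : (u : G) = g⁻¹ * x * g⁻¹⁻¹ := e
          rw [this]; group
        rw [cIndRep_bracket, e', bracket_mul_mem, h u hu]

/-- The centre acts on the compact induction as on the inducing representation. -/
theorem cIndRep_center {σ : Representation k H M} {z : G} (hz : z ∈ Subgroup.center G)
    (hzH : z ∈ H) {c : k} (hc : ∀ v, σ ⟨z, hzH⟩ v = c • v) (f : cInd σ) :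
    cIndRep σ z f = c • f := by
  ext x
  change f.1 (x * z) = c • f.1 x
  rw [Subgroup.mem_center_iff.1 hz x, ← hc]
  exact f.2.2.2 ⟨z, hzH⟩ x

variable {L : Type*} [AddCommGroup L] [Module k L]

/-- The linear map `f ↦ ∑ g φ(f(g⁻¹))`, over representatives `g` of `G / H`, attached to a linear
map `φ` to a representation of `G`. -/
def cIndMap (hH : IsOpen (H : Set G)) {σ : Representation k H M} (ρ : Representation k G L)
    (φ : M →ₗ[k] L) : cInd σ →ₗ[k] L where
  toFun f := ∑ᶠ q : G ⧸ H, ρ q.out (φ (f.1 q.out⁻¹))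
  map_add' f f' := by
    have key (f : cInd σ) :
        (Function.support fun q : G ⧸ H => ρ q.out (φ (f.1 q.out⁻¹))).Finite :=
      (support_out_finite hH f).subset fun q hq h0 => hq (by simp [h0])
    rw [← finsum_add_distrib (key f) (key f')]
    simp
  map_smul' c f := by
    have key : (Function.support fun q : G ⧸ H => ρ q.out (φ (f.1 q.out⁻¹))).Finite :=
      (support_out_finite hH f).subset fun q hq h0 => hq (by simp [h0])
    rw [RingHom.id_apply, smul_finsum' c key]
    simp

/-- Without equivariance of `φ` the value depends on the chosen representative `g h⁻¹` of `g H`.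
This form is what measures the defect of a merely linear lift. -/
theorem exists_cIndMap_bracket (hH : IsOpen (H : Set G)) (σ : Representation k H M) [IsSmooth σ]
    (ρ : Representation k G L) (φ : M →ₗ[k] L) (g : G) (v : M) :
    ∃ h : H, cIndMap hH ρ φ (bracket hH σ g v) = ρ (g * (h : G)⁻¹) (φ (σ h v)) := by
  have hg : (g : G ⧸ H).out⁻¹ * g ∈ H := QuotientGroup.eq.1 (QuotientGroup.out_eq' (g : G ⧸ H))
  refine ⟨⟨_, hg⟩, ?_⟩
  change ∑ᶠ q : G ⧸ H, _ = _
  rw [finsum_eq_single _ (g : G ⧸ H)]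
  · rw [bracket_apply_of_mem hH σ hg]
    simp
  · intro q hq
    rw [bracket_apply_of_notMem hH σ (fun hm => hq ?_), map_zero, map_zero]
    rw [← QuotientGroup.out_eq' q]
    exact QuotientGroup.eq.2 hm

theorem cIndMap_bracket (hH : IsOpen (H : Set G)) (σ : Representation k H M) [IsSmooth σ]
    (ρ : Representation k G L) (φ : M →ₗ[k] L) (hφ : ∀ (h : H) v, φ (σ h v) = ρ h (φ v))
    (g : G) (v : M) : cIndMap hH ρ φ (bracket hH σ g v) = ρ g (φ v) := by
  obtain ⟨h, e⟩ := exists_cIndMap_bracket hH σ ρ φ g v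
  rw [e, hφ, ← Module.End.mul_apply, ← map_mul, inv_mul_cancel_right]

variable {V : Type*} [AddCommGroup V] [Module k V]

/-- `frobenius` unfolds to `cIndMap` of the inclusion of `W`, which is equivariant. -/
theorem frobenius_bracket (hH : IsOpen (H : Set G)) (ρ : Representation k G V) [IsSmooth ρ]
    (W : Subrepresentation (res ρ H)) (g : G) (w : W.toSubmodule) :
    frobenius hH ρ W (bracket hH W.toRepresentation g w) = ρ g w :=
  cIndMap_bracket hH W.toRepresentation ρ W.toSubmodule.subtype (fun _ _ => rfl) g w

theorem frobenius_cIndRep (hH : IsOpen (H : Set G)) (ρ : Representation k G V) [IsSmooth ρ]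
    (W : Subrepresentation (res ρ H)) (g : G) (f : cInd W.toRepresentation) :
    frobenius hH ρ W (cIndRep W.toRepresentation g f) = ρ g (frobenius hH ρ W f) := by
  induction f using cInd_induction hH W.toRepresentation with
  | zero => simp
  | add a b ha hb => simp [ha, hb]
  | bracket a v => simp [cIndRep_bracket, frobenius_bracket]

theorem cIndRep_mem_ker_frobenius (hH : IsOpen (H : Set G)) (ρ : Representation k G V)
    [IsSmooth ρ] (W : Subrepresentation (res ρ H)) (g : G) (f : cInd W.toRepresentation)
    (hf : f ∈ LinearMap.ker (frobenius hH ρ W)) :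
    cIndRep W.toRepresentation g f ∈ LinearMap.ker (frobenius hH ρ W) := by
  rw [LinearMap.mem_ker] at hf ⊢
  rw [frobenius_cIndRep, hf, map_zero]

theorem frobenius_surjective (hH : IsOpen (H : Set G)) (ρ : Representation k G V) [IsSmooth ρ]
    (W : Subrepresentation (res ρ H)) (hW : gspan ρ (W.toSubmodule : Set V) = ⊤) :
    Function.Surjective (frobenius hH ρ W) := by
  rw [← LinearMap.range_eq_top, eq_top_iff, ← hW]
  refine gspan_le ?_ fun w hw => ⟨bracket hH _ 1 ⟨w, hw⟩, by simp [frobenius_bracket]⟩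
  rintro g _ ⟨f, rfl⟩
  exact ⟨_, frobenius_cIndRep hH ρ W g f⟩

end CompactInduction

/-! ### Finiteness does not depend on the generating subspace -/

section Independence

variable {k G V : Type*} [Field k] [Group G] [AddCommGroup V] [Module k V]
  {H : Subgroup G}

/-- A representation is locally finite over a subgroup `H` if the `H`-translates of any vector
span a finite-dimensional subspace. -/
def IsLocallyFinite (ρ : Representation k G V) (H : Subgroup G) : Prop :=
  ∀ v : V, ∃ D : Submodule k V, FiniteDimensional k D ∧ ∀ h ∈ H, ρ h v ∈ D

/-- Every finite-dimensional subspace of a locally finite representation is contained in a stable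
one. -/
theorem IsLocallyFinite.exists_submodule {ρ : Representation k G V} (hρ : IsLocallyFinite ρ H)
    (E : Submodule k V) [hE : FiniteDimensional k E] :
    ∃ D : Submodule k V, FiniteDimensional k D ∧ ∀ h ∈ H, ∀ v ∈ E, ρ h v ∈ D := by
  induction E, (Submodule.fg_iff_finiteDimensional E).2 hE using Submodule.fg_induction with
  | singleton v =>
    obtain ⟨D, hD, h⟩ := hρ v
    refine ⟨D, hD, fun g hg w hw => ?_⟩
    obtain ⟨c, rfl⟩ := Submodule.mem_span_singleton.1 hw
    rw [map_smul]
    exact D.smul_mem c (h g hg)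
  | sup E₁ E₂ h₁ h₂ ih₁ ih₂ =>
    obtain ⟨D₁, hD₁, h₁⟩ := ih₁
    obtain ⟨D₂, hD₂, h₂⟩ := ih₂
    refine ⟨D₁ ⊔ D₂, inferInstance, fun g hg w hw => ?_⟩
    obtain ⟨a, ha, b, hb, rfl⟩ := Submodule.mem_sup.1 hw
    rw [map_add]
    exact Submodule.add_mem_sup (h₁ g hg a ha) (h₂ g hg b hb)

variable [TopologicalSpace G] [IsTopologicalGroup G]

/-- The kernel of the presentation attached to one generating subspace is finitely generated as
soon as the kernel attached to another one is. -/
theorem isFinGen_ker_frobenius (hH : IsOpen (H : Set G)) (ρ : Representation k G V) [IsSmooth ρ]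
    (W W' : Subrepresentation (res ρ H)) [FiniteDimensional k W.toSubmodule]
    [FiniteDimensional k W'.toSubmodule]
    (hW : gspan ρ (W.toSubmodule : Set V) = ⊤) (hW' : gspan ρ (W'.toSubmodule : Set V) = ⊤)
    (hloc : IsLocallyFinite (cIndRep W'.toRepresentation) H)
    (hfin : IsFinGen (cIndRep W.toRepresentation) (LinearMap.ker (frobenius hH ρ W))) :
    IsFinGen (cIndRep W'.toRepresentation) (LinearMap.ker (frobenius hH ρ W')) := by
  set σ := W.toRepresentation with hσ
  set σ' := W'.toRepresentation with hσ'
  obtain ⟨s, hs⟩ := LinearMap.exists_rightInverse_of_surjective (frobenius hH ρ W)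
    (LinearMap.range_eq_top.2 (frobenius_surjective hH ρ W hW))
  obtain ⟨s', hs'⟩ := LinearMap.exists_rightInverse_of_surjective (frobenius hH ρ W')
    (LinearMap.range_eq_top.2 (frobenius_surjective hH ρ W' hW'))
  replace hs (v : V) : frobenius hH ρ W (s v) = v := LinearMap.congr_fun hs v
  replace hs' (v : V) : frobenius hH ρ W' (s' v) = v := LinearMap.congr_fun hs' v
  let φ : W.toSubmodule →ₗ[k] cInd σ' := s' ∘ₗ W.toSubmodule.subtype
  -- `s'` is only a linear section, so `Φ` is `G`-equivariant only modulo the submodule generated by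
  -- the defects `T₁`.
  let Φ : cInd σ →ₗ[k] cInd σ' := cIndMap hH (cIndRep σ') φ
  let T₁ : Set (cInd σ') :=
    {f | ∃ (h : H) (w : W.toSubmodule), f = φ (σ h w) - cIndRep σ' h (φ w)}
  have hΦb (g : G) (w : W.toSubmodule) :
      Φ (bracket hH σ g w) - cIndRep σ' g (φ w) ∈ gspan (cIndRep σ') T₁ := by
    obtain ⟨h, e⟩ := exists_cIndMap_bracket hH σ (cIndRep σ') φ g w
    have e' : Φ (bracket hH σ g w) - cIndRep σ' g (φ w) =
        cIndRep σ' (g * (h : G)⁻¹) (φ (σ h w) - cIndRep σ' h (φ w)) := by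
      rw [map_sub, ← Module.End.mul_apply (cIndRep σ' (g * (h : G)⁻¹)), ← map_mul,
        inv_mul_cancel_right]
      exact congrArg (· - _) e
    rw [e']
    exact apply_mem_gspan _ (subset_gspan _ ⟨h, w, rfl⟩)
  have hΦ (g : G) (f : cInd σ) :
      Φ (cIndRep σ g f) - cIndRep σ' g (Φ f) ∈ gspan (cIndRep σ') T₁ := by
    induction f using cInd_induction hH σ with
    | zero => simp
    | add a b ha hb =>
      simp only [map_add]
      rw [add_sub_add_comm]
      exact add_mem ha hb
    | bracket a w =>
      rw [cIndRep_bracket]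
      have h₁ := hΦb (g * a) w
      have h₂ := apply_mem_gspan g (hΦb a w)
      rw [map_sub, ← Module.End.mul_apply, ← map_mul] at h₂
      have := sub_mem h₁ h₂
      rwa [sub_sub_sub_cancel_right] at this
  have hT₁ker : gspan (cIndRep σ') T₁ ≤ LinearMap.ker (frobenius hH ρ W') := by
    refine gspan_le (cIndRep_mem_ker_frobenius hH ρ W') ?_
    rintro _ ⟨h, w, rfl⟩
    have e₁ : frobenius hH ρ W' (φ (σ h w)) = ρ h w := hs' _
    have e₂ : frobenius hH ρ W' (φ w) = w := hs' _
    rw [SetLike.mem_coe, LinearMap.mem_ker, map_sub, frobenius_cIndRep, e₁, e₂, sub_self]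
  have hfrob (f : cInd σ) : frobenius hH ρ W' (Φ f) = frobenius hH ρ W f := by
    induction f using cInd_induction hH σ with
    | zero => simp
    | add a b ha hb => simp [ha, hb]
    | bracket g w =>
      have h₁ := hT₁ker (hΦb g w)
      have e₂ : frobenius hH ρ W' (φ w) = w := hs' _
      rw [LinearMap.mem_ker, map_sub, sub_eq_zero, frobenius_cIndRep, e₂] at h₁
      rw [h₁, frobenius_bracket]
  obtain ⟨S, hS, hSker⟩ := hfin
  let δ : W'.toSubmodule →ₗ[k] cInd σ' :=
    bracketₗ hH σ' 1 - Φ ∘ₗ s ∘ₗ W'.toSubmodule.subtype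
  let T : Set (cInd σ') := T₁ ∪ Φ '' S ∪ Set.range δ
  have hT₁T : gspan (cIndRep σ') T₁ ≤ gspan (cIndRep σ') T :=
    gspan_mono fun _ h => Or.inl (Or.inl h)
  have hker : gspan (cIndRep σ') T = LinearMap.ker (frobenius hH ρ W') := by
    refine le_antisymm (gspan_le (cIndRep_mem_ker_frobenius hH ρ W') ?_) fun f hf => ?_
    · rintro _ ((h | ⟨f, hf, rfl⟩) | ⟨w, rfl⟩)
      · exact hT₁ker (subset_gspan _ h)
      · have : f ∈ LinearMap.ker (frobenius hH ρ W) := hSker ▸ subset_gspan S hf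
        rw [SetLike.mem_coe, LinearMap.mem_ker, hfrob]
        exact this
      · have e : frobenius hH ρ W (s w) = w := hs _
        change frobenius hH ρ W' (bracket hH σ' 1 w - Φ (s w)) = 0
        rw [map_sub, frobenius_bracket, hfrob, e]
        simp
    -- Modulo `T`, every `f` comes through `Φ` from some `e` with the same image in `V`. If `f` is a
    -- relation, so is `e`, and then `Φ e` is controlled by `Φ '' S`.
    · have key (f : cInd σ') : ∃ e : cInd σ, frobenius hH ρ W e = frobenius hH ρ W' f ∧
          f - Φ e ∈ gspan (cIndRep σ') T := by
        induction f using cInd_induction hH σ' with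
        | zero => exact ⟨0, by simp, by simp⟩
        | add a b ha hb =>
          obtain ⟨x, hx, hx'⟩ := ha
          obtain ⟨y, hy, hy'⟩ := hb
          refine ⟨x + y, by simp [hx, hy], ?_⟩
          rw [map_add, add_sub_add_comm]
          exact add_mem hx' hy'
        | bracket g w =>
          refine ⟨cIndRep σ g (s w), by rw [frobenius_cIndRep, hs, frobenius_bracket], ?_⟩
          have h₁ : cIndRep σ' g (bracket hH σ' 1 w - Φ (s w)) ∈ gspan (cIndRep σ') T :=
            apply_mem_gspan g (subset_gspan _ (Or.inr ⟨w, rfl⟩))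
          have h₂ := hT₁T (hΦ g (s w))
          rw [map_sub, cIndRep_bracket, mul_one] at h₁
          have := sub_mem h₁ h₂
          rwa [sub_sub_sub_cancel_right] at this
      obtain ⟨e, he, he'⟩ := key f
      have heR : e ∈ gspan (cIndRep σ) S := by
        rw [hSker, LinearMap.mem_ker, he]
        exact hf
      have hΦe : gspan (cIndRep σ) S ≤ (gspan (cIndRep σ') T).comap Φ := by
        refine gspan_le (fun g v hv => ?_) fun v hv =>
          subset_gspan _ (Or.inl (Or.inr ⟨v, hv, rfl⟩))
        have := add_mem (hT₁T (hΦ g v)) (apply_mem_gspan g (Submodule.mem_comap.1 hv))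
        rwa [sub_add_cancel] at this
      have := add_mem he' (Submodule.mem_comap.1 (hΦe heR))
      rwa [sub_add_cancel] at this
  rw [← hker]
  -- `T₁` is indexed by all of `H`; local finiteness confines the terms `h φ(w)` to the
  -- finite-dimensional `D`.
  obtain ⟨D, hD, hφD⟩ := hloc.exists_submodule (LinearMap.range φ)
  have : FiniteDimensional k (Submodule.span k (Φ '' S)) :=
    FiniteDimensional.span_of_finite k (hS.image Φ)
  refine isFinGen_gspan_of_subset
    (D := (LinearMap.range φ ⊔ D) ⊔ Submodule.span k (Φ '' S) ⊔ LinearMap.range δ) ?_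
  rintro _ ((⟨h, w, rfl⟩ | hf) | ⟨w, rfl⟩)
  · refine Submodule.mem_sup_left (Submodule.mem_sup_left (sub_mem ?_ ?_))
    · exact Submodule.mem_sup_left ⟨_, rfl⟩
    · exact Submodule.mem_sup_right (hφD h h.2 _ ⟨w, rfl⟩)
  · exact Submodule.mem_sup_left (Submodule.mem_sup_right (Submodule.subset_span hf))
  · exact Submodule.mem_sup_right ⟨w, rfl⟩

end Independence

/-! ### Edge relations and enlarging the generating subspace -/

section Standard

variable {k G V : Type*} [Field k] [Group G]
  [AddCommGroup V] [Module k V] {H : Subgroup G} {α : G}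

/-- The elements `g` of `G` such that the vertex `g H` is at distance at most `n` from the vertex
`H` in the graph on `G / H` whose edges join `g H` and `g α H`. -/
def ball (H : Subgroup G) (α : G) : ℕ → Set G
  | 0 => H
  | n + 1 => ball H α n ∪ {g | ∃ h ∈ H, ∃ a, (a = α ∨ a = α⁻¹) ∧ ∃ b ∈ ball H α n, g = h * a * b}

theorem ball_mono : Monotone (ball H α) :=
  monotone_nat_of_le_succ fun _ => Set.subset_union_left

theorem mul_mem_ball {n : ℕ} {h g : G} (hh : h ∈ H) (hg : g ∈ ball H α n) :
    h * g ∈ ball H α n := by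
  induction n with
  | zero => exact H.mul_mem hh hg
  | succ n ih =>
    rcases hg with hg | ⟨h', hh', a, ha, b, hb, rfl⟩
    · exact Or.inl (ih hg)
    · exact Or.inr ⟨h * h', H.mul_mem hh hh', a, ha, b, hb, by simp only [mul_assoc]⟩

theorem mul_left_mem_ball_succ {n : ℕ} {a g : G} (ha : a = α ∨ a = α⁻¹) (hg : g ∈ ball H α n) :
    a * g ∈ ball H α (n + 1) :=
  Or.inr ⟨1, H.one_mem, a, ha, g, hg, by simp⟩

theorem exists_mem_ball (hgen : H ⊔ Subgroup.zpowers α = ⊤) (g : G) : ∃ n, g ∈ ball H α n := by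
  have hg : g ∈ Subgroup.closure ((H : Set G) ∪ {α}) := by
    rw [Subgroup.closure_union, Subgroup.closure_eq, ← Subgroup.zpowers_eq_closure, hgen]
    trivial
  induction hg using Subgroup.closure_induction_left with
  | one => exact ⟨0, H.one_mem⟩
  | mul_left x hx y _ ih =>
    obtain ⟨n, hn⟩ := ih
    rcases hx with hx | rfl
    · exact ⟨n, mul_mem_ball hx hn⟩
    · exact ⟨n + 1, mul_left_mem_ball_succ (Or.inl rfl) hn⟩
  | inv_mul_cancel x hx y _ ih =>
    obtain ⟨n, hn⟩ := ih
    rcases hx with hx | rfl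
    · exact ⟨n, mul_mem_ball (H.inv_mem hx) hn⟩
    · exact ⟨n + 1, mul_left_mem_ball_succ (Or.inr rfl) hn⟩

/-- The `H`-stable subspace spanned by the translates of `W` by the elements of the ball of radius
`n`. -/
def ballSpan (ρ : Representation k G V) (W : Subrepresentation (res ρ H)) (α : G) (n : ℕ) :
    Subrepresentation (res ρ H) where
  toSubmodule := Submodule.span k {v | ∃ g ∈ ball H α n, ∃ w ∈ W.toSubmodule, v = ρ g w}
  apply_mem_toSubmodule h v hv := by
    refine map_mem_span (T := ρ h) ?_ hv
    rintro _ ⟨g, hg, w, hw, rfl⟩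
    exact Submodule.subset_span ⟨h * g, mul_mem_ball h.2 hg, w, hw, by simp⟩

theorem apply_mem_ballSpan (ρ : Representation k G V) (W : Subrepresentation (res ρ H)) {n : ℕ}
    {g : G} (hg : g ∈ ball H α n) {w : V} (hw : w ∈ W.toSubmodule) :
    ρ g w ∈ (ballSpan ρ W α n).toSubmodule :=
  Submodule.subset_span ⟨g, hg, w, hw, rfl⟩

theorem le_ballSpan (ρ : Representation k G V) (W : Subrepresentation (res ρ H)) (n : ℕ) :
    W.toSubmodule ≤ (ballSpan ρ W α n).toSubmodule := fun w hw => by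
  have h1 : (1 : G) ∈ ball H α n := ball_mono n.zero_le H.one_mem
  simpa using apply_mem_ballSpan ρ W h1 hw

theorem finiteDimensional_ballSpan {ρ : Representation k G V} (hρ : IsLocallyFinite ρ H)
    (W : Subrepresentation (res ρ H)) [hW : FiniteDimensional k W.toSubmodule] (n : ℕ) :
    FiniteDimensional k (ballSpan ρ W α n).toSubmodule := by
  induction n with
  | zero =>
    refine Submodule.finiteDimensional_of_le (S₂ := W.toSubmodule) (Submodule.span_le.2 ?_)
    rintro _ ⟨g, hg, w, hw, rfl⟩
    exact W.apply_mem_toSubmodule ⟨g, hg⟩ hw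
  | succ n ih =>
    set E := (ballSpan ρ W α n).toSubmodule with hE
    -- The new translates are `H`-translates of `α E + α⁻¹ E`.
    obtain ⟨D, hD, h⟩ := hρ.exists_submodule (E.map (ρ α) ⊔ E.map (ρ α⁻¹))
    refine Submodule.finiteDimensional_of_le (S₂ := E ⊔ D) (Submodule.span_le.2 ?_)
    rintro _ ⟨g, hg | ⟨h', hh', a, ha, b, hb, rfl⟩, w, hw, rfl⟩
    · exact Submodule.mem_sup_left (apply_mem_ballSpan ρ W hg hw)
    · refine Submodule.mem_sup_right ?_
      rw [map_mul, map_mul, Module.End.mul_apply, Module.End.mul_apply]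
      refine h h' hh' _ ?_
      rcases ha with rfl | rfl
      · exact Submodule.mem_sup_left ⟨_, apply_mem_ballSpan ρ W hb hw, rfl⟩
      · exact Submodule.mem_sup_right ⟨_, apply_mem_ballSpan ρ W hb hw, rfl⟩

variable [TopologicalSpace G] [IsTopologicalGroup G]

/-- The relations `[α, x] - [1, α x]`, with both `x` and `α x` in `W`. -/
def edgeRelations (hH : IsOpen (H : Set G)) (ρ : Representation k G V) [IsSmooth ρ]
    (W : Subrepresentation (res ρ H)) (α : G) : Set (cInd W.toRepresentation) :=
  {f | ∃ x y : W.toSubmodule, ρ α (x : V) = y ∧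
    f = bracket hH W.toRepresentation α x - bracket hH W.toRepresentation 1 y}

theorem edgeRelations_subset_ker (hH : IsOpen (H : Set G)) (ρ : Representation k G V)
    [IsSmooth ρ] (W : Subrepresentation (res ρ H)) :
    edgeRelations hH ρ W α ⊆ LinearMap.ker (frobenius hH ρ W) := by
  rintro _ ⟨x, y, e, rfl⟩
  rw [SetLike.mem_coe, LinearMap.mem_ker, map_sub, frobenius_bracket, frobenius_bracket, e]
  simp

theorem isFinGen_gspan_edgeRelations (hH : IsOpen (H : Set G)) (ρ : Representation k G V)
    [IsSmooth ρ] (W : Subrepresentation (res ρ H)) [FiniteDimensional k W.toSubmodule] :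
    IsFinGen (cIndRep W.toRepresentation)
      (gspan (cIndRep W.toRepresentation) (edgeRelations hH ρ W α)) := by
  refine isFinGen_gspan_of_subset (D := LinearMap.range (bracketₗ hH W.toRepresentation α) ⊔
    LinearMap.range (bracketₗ hH W.toRepresentation 1)) ?_
  rintro _ ⟨x, y, -, rfl⟩
  exact sub_mem (Submodule.mem_sup_left ⟨x, rfl⟩) (Submodule.mem_sup_right ⟨y, rfl⟩)

/-- Modulo the edge relations, a vector may be moved along an edge. -/
theorem bracket_sub_bracket_mem_gspan (hH : IsOpen (H : Set G)) (ρ : Representation k G V)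
    [IsSmooth ρ] (W : Subrepresentation (res ρ H)) {a : G} (ha : a = α ∨ a = α⁻¹) (g : G)
    (x y : W.toSubmodule) (e : ρ a (x : V) = y) :
    bracket hH W.toRepresentation (g * a) x - bracket hH W.toRepresentation g y ∈
      gspan (cIndRep W.toRepresentation) (edgeRelations hH ρ W α) := by
  rcases ha with rfl | rfl
  · have := apply_mem_gspan (ρ := cIndRep W.toRepresentation) g
      (subset_gspan _ (show _ ∈ edgeRelations hH ρ W a from ⟨x, y, e, rfl⟩))
    rwa [map_sub, cIndRep_bracket, cIndRep_bracket, mul_one] at this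
  · have e' : ρ α (y : V) = x := by
      rw [← e, ← Module.End.mul_apply, ← map_mul]; simp
    -- The same edge traversed backwards: translate the relation for `y` by `g α⁻¹` and change sign.
    have := apply_mem_gspan (ρ := cIndRep W.toRepresentation) (g * α⁻¹)
      (subset_gspan _ (show _ ∈ edgeRelations hH ρ W α from ⟨y, x, e', rfl⟩))
    rw [map_sub, cIndRep_bracket, cIndRep_bracket, mul_one, inv_mul_cancel_right] at this
    rw [← neg_sub]
    exact neg_mem this

/-- Modulo the edge relations of `ballSpan ρ W α n`, a vector of a translate of `W` may be moved
along a path of length at most `n`. -/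
theorem bracket_mul_sub_bracket_mem_gspan (hH : IsOpen (H : Set G)) (ρ : Representation k G V)
    [IsSmooth ρ] (W : Subrepresentation (res ρ H)) (n : ℕ) {m : ℕ} (hm : m ≤ n) {g : G}
    (hg : g ∈ ball H α m) (a : G) (w : V) (hw : w ∈ W.toSubmodule) :
    bracket hH (ballSpan ρ W α n).toRepresentation (a * g) ⟨w, le_ballSpan ρ W n hw⟩ -
      bracket hH (ballSpan ρ W α n).toRepresentation a
        ⟨ρ g w, apply_mem_ballSpan ρ W (ball_mono hm hg) hw⟩ ∈
      gspan (cIndRep (ballSpan ρ W α n).toRepresentation)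
        (edgeRelations hH ρ (ballSpan ρ W α n) α) := by
  induction m generalizing g a with
  | zero =>
    rw [show a * g = a * ((⟨g, hg⟩ : H) : G) from rfl, bracket_mul_mem]
    convert Submodule.zero_mem _
    exact sub_self _
  | succ m ih =>
    rcases id hg with hg' | ⟨h, hh, c, hc, b, hb, rfl⟩
    · exact ih (m.le_succ.trans hm) hg' a
    -- For `g = h c b` the moves are `[ahcb, w] ≡ [ahc, bw] ≡ [ah, cbw] = [a, hcbw]`. The vectors
    -- `bw` and `cbw` lie in `ballSpan ρ W α n` since `b` and `c b` stay in the ball of radius `m +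
    -- 1 ≤ n`.
    · have hbn : b ∈ ball H α n := ball_mono (m.le_succ.trans hm) hb
      have hcn : c * b ∈ ball H α n := ball_mono hm (mul_left_mem_ball_succ hc hb)
      have h₁ := ih (m.le_succ.trans hm) hb (a * h * c)
      have h₂ := bracket_sub_bracket_mem_gspan hH ρ (ballSpan ρ W α n) hc (a * h)
        ⟨ρ b w, apply_mem_ballSpan ρ W hbn hw⟩ ⟨ρ (c * b) w, apply_mem_ballSpan ρ W hcn hw⟩
        (by simp)
      have h₃ := add_mem h₁ h₂
      rw [sub_add_sub_cancel, show a * h = a * ((⟨h, hh⟩ : H) : G) from rfl,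
        bracket_mul_mem _ _ a] at h₃
      convert h₃ using 3
      · simp only [mul_assoc]
      · refine Subtype.ext ?_
        change ρ (h * c * b) w = ρ h (ρ (c * b) w)
        rw [mul_assoc, map_mul _ h, Module.End.mul_apply]

/-- If the presentation attached to `W` is finite, then the presentation attached to a large
enough ball of translates of `W` is generated by the edge relations. -/
theorem exists_gspan_edgeRelations_eq_ker (hH : IsOpen (H : Set G)) (ρ : Representation k G V)
    [IsSmooth ρ] (hgen : H ⊔ Subgroup.zpowers α = ⊤) (W : Subrepresentation (res ρ H))
    (hfin : IsFinGen (cIndRep W.toRepresentation) (LinearMap.ker (frobenius hH ρ W))) :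
    ∃ n, gspan (cIndRep (ballSpan ρ W α n).toRepresentation)
        (edgeRelations hH ρ (ballSpan ρ W α n) α) =
      LinearMap.ker (frobenius hH ρ (ballSpan ρ W α n)) := by
  set σ := W.toRepresentation with hσ
  obtain ⟨S, hS, hSker⟩ := hfin
  let B (n : ℕ) : Submodule k (cInd σ) := Submodule.span k
    {f | ∃ g ∈ ball H α n, ∃ w, f = bracket hH σ g w}
  have hBmono : Monotone B := fun m n hmn => Submodule.span_mono
    fun _ ⟨g, hg, w, e⟩ => ⟨g, ball_mono hmn hg, w, e⟩
  have hBtop (f : cInd σ) : ∃ n, f ∈ B n := by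
    induction f using cInd_induction hH σ with
    | zero => exact ⟨0, zero_mem _⟩
    | add a b ha hb =>
      obtain ⟨m, hm⟩ := ha
      obtain ⟨n, hn⟩ := hb
      exact ⟨max m n, add_mem (hBmono (le_max_left m n) hm) (hBmono (le_max_right m n) hn)⟩
    | bracket g w =>
      obtain ⟨n, hn⟩ := exists_mem_ball hgen g
      exact ⟨n, Submodule.subset_span ⟨g, hn, w, rfl⟩⟩
  obtain ⟨n, hSn⟩ : ∃ n, S ⊆ B n := by
    choose N hN using hBtop
    obtain ⟨n, hn⟩ := (hS.image N).bddAbove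
    exact ⟨n, fun f hf => hBmono (hn ⟨f, hf, rfl⟩) (hN f)⟩
  refine ⟨n, ?_⟩
  set Wn := ballSpan ρ W α n with hWn
  set τ := Wn.toRepresentation with hτ
  set N := gspan (cIndRep τ) (edgeRelations hH ρ Wn α) with hN
  have hNker : N ≤ LinearMap.ker (frobenius hH ρ Wn) :=
    gspan_le (cIndRep_mem_ker_frobenius hH ρ Wn) (edgeRelations_subset_ker hH ρ Wn)
  let ι : W.toSubmodule →ₗ[k] Wn.toSubmodule := Submodule.inclusion (le_ballSpan ρ W n)
  let j : cInd σ →ₗ[k] cInd τ := cIndMap hH (cIndRep τ) (bracketₗ hH τ 1 ∘ₗ ι)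
  have hj (g : G) (w : W.toSubmodule) : j (bracket hH σ g w) = bracket hH τ g (ι w) := by
    have := cIndMap_bracket hH σ (cIndRep τ) (bracketₗ hH τ 1 ∘ₗ ι) (fun h v => ?_) g w
    · rw [LinearMap.comp_apply, bracketₗ_apply, cIndRep_bracket, mul_one] at this
      exact this
    · rw [LinearMap.comp_apply, LinearMap.comp_apply, bracketₗ_apply, bracketₗ_apply,
        cIndRep_bracket, mul_one]
      have := bracket_mul_mem hH τ 1 h (ι v)
      rw [one_mul] at this
      rw [this]
      rfl
  have hjG (g : G) (f : cInd σ) : j (cIndRep σ g f) = cIndRep τ g (j f) := by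
    induction f using cInd_induction hH σ with
    | zero => simp
    | add a b ha hb => simp [ha, hb]
    | bracket a v => rw [cIndRep_bracket, hj, hj, cIndRep_bracket]
  have hjF (f : cInd σ) : frobenius hH ρ Wn (j f) = frobenius hH ρ W f := by
    induction f using cInd_induction hH σ with
    | zero => simp
    | add a b ha hb => simp [ha, hb]
    | bracket a v => rw [hj, frobenius_bracket, frobenius_bracket]; rfl
  have hsurj (f : cInd τ) : ∃ e, f - j e ∈ N := by
    induction f using cInd_induction hH τ with
    | zero => exact ⟨0, by simp⟩
    | add a b ha hb =>
      obtain ⟨x, hx⟩ := ha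
      obtain ⟨y, hy⟩ := hb
      refine ⟨x + y, ?_⟩
      rw [map_add, add_sub_add_comm]
      exact add_mem hx hy
    | bracket a v =>
      -- `Wn` is a span inside `V`, so the condition on elements of the subtype is pushed forward to
      -- `V` to be checked on generators.
      have key : Wn.toSubmodule ≤
          ((N ⊔ LinearMap.range j).comap (bracketₗ hH τ a)).map Wn.toSubmodule.subtype := by
        refine Submodule.span_le.2 ?_
        rintro _ ⟨g, hg, w, hw, rfl⟩
        refine ⟨⟨ρ g w, apply_mem_ballSpan ρ W hg hw⟩, ?_, rfl⟩
        have h₁ := bracket_mul_sub_bracket_mem_gspan hH ρ W n le_rfl hg a w hw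
        have h₂ : bracket hH τ (a * g) ⟨w, le_ballSpan ρ W n hw⟩ ∈ LinearMap.range j :=
          ⟨bracket hH σ (a * g) ⟨w, hw⟩, hj _ _⟩
        have := sub_mem (Submodule.mem_sup_right (S := N) h₂) (Submodule.mem_sup_left h₁)
        rwa [sub_sub_cancel] at this
      obtain ⟨v', hv', e⟩ := key v.2
      obtain rfl : v' = v := Subtype.ext e
      obtain ⟨x, hx, _, ⟨y, rfl⟩, e⟩ := Submodule.mem_sup.1 (Submodule.mem_comap.1 hv')
      exact ⟨y, by rwa [← bracketₗ_apply, ← e, add_sub_cancel_right]⟩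
  -- Anything supported in the ball can be gathered at the base vertex, where only its image in `V`
  -- remains; for a relation this image is zero.
  have hball (f : cInd σ) (hf : f ∈ B n) :
      ∃ v : Wn.toSubmodule, frobenius hH ρ W f = v ∧ j f - bracketₗ hH τ 1 v ∈ N := by
    refine Submodule.span_induction ?_ ?_ ?_ ?_ hf
    · rintro _ ⟨g, hg, w, rfl⟩
      refine ⟨⟨ρ g w, apply_mem_ballSpan ρ W hg w.2⟩, frobenius_bracket hH ρ W g w, ?_⟩
      have := bracket_mul_sub_bracket_mem_gspan hH ρ W n le_rfl hg 1 w w.2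
      rw [one_mul] at this
      rw [hj]
      exact this
    · exact ⟨0, by simp, by rw [map_zero, map_zero, sub_zero]; exact N.zero_mem⟩
    · rintro a b _ _ ⟨x, hx, hx'⟩ ⟨y, hy, hy'⟩
      refine ⟨x + y, by simp [hx, hy], ?_⟩
      rw [map_add, map_add, add_sub_add_comm]
      exact add_mem hx' hy'
    · rintro c a _ ⟨x, hx, hx'⟩
      refine ⟨c • x, by simp [hx], ?_⟩
      have := N.smul_mem c hx'
      rw [smul_sub] at this
      rw [map_smul, map_smul]
      exact this
  refine le_antisymm hNker fun f hf => ?_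
  obtain ⟨e, he⟩ := hsurj f
  have heR : e ∈ gspan (cIndRep σ) S := by
    have h₁ := hNker he
    rw [LinearMap.mem_ker, map_sub, LinearMap.mem_ker.1 hf, hjF, zero_sub, neg_eq_zero] at h₁
    rwa [hSker]
  have hjN : gspan (cIndRep σ) S ≤ N.comap j := by
    refine gspan_le (fun g v hv => ?_) fun v hv => ?_
    · rw [Submodule.mem_comap, hjG]
      exact apply_mem_gspan g hv
    · obtain ⟨x, hx, hx'⟩ := hball v (hSn hv)
      have h₀ : v ∈ LinearMap.ker (frobenius hH ρ W) := hSker ▸ subset_gspan S hv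
      obtain rfl : x = 0 := Subtype.ext (hx.symm.trans h₀)
      rwa [map_zero, sub_zero] at hx'
  have := add_mem he (Submodule.mem_comap.1 (hjN heR))
  rwa [sub_add_cancel] at this

end Standard

/-! ### Generators of `GL₂` of a field -/

section Generation

/-- The homomorphism `a ↦ diag(a, 1)`. -/
def diagHom (R : Type*) [CommRing R] : Rˣ →* GL (Fin 2) R :=
  Units.map
    { toFun := fun a => !![a, 0; 0, 1]
      map_one' := by simp [Matrix.one_fin_two]
      map_mul' := fun a b => by simp }

/-- The upper triangular matrix with ones on the diagonal and corner entry `c`. -/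
def upperUnip {R : Type*} [CommRing R] (c : R) : GL (Fin 2) R :=
  ⟨!![1, c; 0, 1], !![1, -c; 0, 1], by simp [Matrix.one_fin_two], by simp [Matrix.one_fin_two]⟩

/-- The lower triangular matrix with ones on the diagonal and corner entry `c`. -/
def lowerUnip {R : Type*} [CommRing R] (c : R) : GL (Fin 2) R :=
  ⟨!![1, 0; c, 1], !![1, 0; -c, 1], by simp [Matrix.one_fin_two], by simp [Matrix.one_fin_two]⟩

variable {E : Type*} [Field E]

/-- `GL₂` of a field is generated by its centre, the matrices `diag(a, 1)` and the two elementary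
unipotent matrices. -/
theorem eq_top_of_generators {S : Subgroup (GL (Fin 2) E)}
    (hZ : Subgroup.center (GL (Fin 2) E) ≤ S) (hd : ∀ a, diagHom E a ∈ S)
    (hu : upperUnip (1 : E) ∈ S) (hl : lowerUnip (1 : E) ∈ S) : S = ⊤ := by
  rw [eq_top_iff]
  intro g _
  -- The induction runs over matrices, so the claim is phrased for every group element with the
  -- given matrix.
  have key : ∀ g' : GL (Fin 2) E, g'.1 = g.1 → g' ∈ S := by
    refine Matrix.diagonal_transvection_induction_of_det_ne_zero
      (fun A => ∀ g' : GL (Fin 2) E, g'.1 = A → g' ∈ S) g.1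
      ((Matrix.isUnit_iff_isUnit_det _).1 g.isUnit).ne_zero ?_ ?_ ?_
    · intro D hD g' e
      rw [Matrix.det_diagonal, Fin.prod_univ_two] at hD
      have h0 : D 0 ≠ 0 := left_ne_zero_of_mul hD
      have h1 : D 1 ≠ 0 := right_ne_zero_of_mul hD
      have hs : Matrix.GeneralLinearGroup.scalar (Fin 2) (Units.mk0 (D 1) h1) ∈ S :=
        hZ (by
          rw [Subgroup.mem_center_iff]
          intro x
          ext i j
          simp [mul_comm])
      have : g' = Matrix.GeneralLinearGroup.scalar (Fin 2) (Units.mk0 (D 1) h1) *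
          diagHom E (Units.mk0 (D 0 / D 1) (div_ne_zero h0 h1)) := by
        refine Units.ext (e.trans ?_)
        ext i j
        fin_cases i <;> fin_cases j <;> simp [diagHom, h1, mul_div_cancel₀]
      rw [this]
      exact S.mul_mem hs (hd _)
    · rintro ⟨i, j, hij, c⟩ g' e
      by_cases hc : c = 0
      · obtain rfl : g' = 1 := Units.ext (e.trans (by
          simp [Matrix.TransvectionStruct.toMatrix, hc]))
        exact S.one_mem
      have hcases : (i = 0 ∧ j = 1) ∨ (i = 1 ∧ j = 0) := by omega
      rcases hcases with ⟨rfl, rfl⟩ | ⟨rfl, rfl⟩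
      -- Conjugation by `diag(c, 1)` scales the upper corner by `c` and the lower one by `c⁻¹`,
      -- hence the inverse in the other case.
      · have : g' = diagHom E (Units.mk0 c hc) * upperUnip 1 * diagHom E (Units.mk0 c hc)⁻¹ := by
          refine Units.ext (e.trans ?_)
          ext i j
          fin_cases i <;> fin_cases j <;>
            simp [diagHom, upperUnip, hc, Matrix.TransvectionStruct.toMatrix, Matrix.transvection,
              Matrix.mul_apply]
        rw [this]
        exact S.mul_mem (S.mul_mem (hd _) hu) (hd _)
      · have : g' = diagHom E (Units.mk0 c hc)⁻¹ * lowerUnip 1 * diagHom E (Units.mk0 c hc) := by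
          refine Units.ext (e.trans ?_)
          ext i j
          fin_cases i <;> fin_cases j <;>
            simp [diagHom, lowerUnip, hc, Matrix.TransvectionStruct.toMatrix, Matrix.transvection,
              Matrix.mul_apply]
        rw [this]
        exact S.mul_mem (S.mul_mem (hd _) hl) (hd _)
    · intro A B hA hB ihA ihB g' e
      have : g' = Matrix.GeneralLinearGroup.mkOfDetNeZero A hA *
          Matrix.GeneralLinearGroup.mkOfDetNeZero B hB := Units.ext e
      rw [this]
      exact S.mul_mem (ihA _ rfl) (ihB _ rfl)
  exact key g rfl

end Generation

/-! ### The case of `GL₂(F)`: generation, local finiteness, conclusions -/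

section GL2

variable {F : Type*} [Field F] [ValuativeRel F] [TopologicalSpace F]
  [IsNonarchimedeanLocalField F]

theorem units_eq_top_of_uniformizer {ϖ : 𝒪[F]} (hϖ : Irreducible ϖ) {T : Subgroup Fˣ}
    (hT : ∀ u : 𝒪[F]ˣ, Units.map (algebraMap 𝒪[F] F : 𝒪[F] →* F) u ∈ T)
    (hϖT : Units.mk0 (ϖ : F) (by simpa using hϖ.ne_zero) ∈ T) : T = ⊤ := by
  have key (a : Fˣ) (ha : (a : F) ∈ 𝒪[F]) : a ∈ T := by
    have h0 : (⟨a, ha⟩ : 𝒪[F]) ≠ 0 := fun h => a.ne_zero (congrArg Subtype.val h)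
    obtain ⟨n, u, e⟩ := IsDiscreteValuationRing.eq_unit_mul_pow_irreducible h0 hϖ
    have : a = Units.map (algebraMap 𝒪[F] F : 𝒪[F] →* F) u *
        Units.mk0 (ϖ : F) (by simpa using hϖ.ne_zero) ^ n :=
      Units.ext (congrArg Subtype.val e)
    rw [this]
    exact T.mul_mem (hT u) (T.pow_mem hϖT n)
  rw [eq_top_iff]
  intro a _
  rcases le_total (ValuativeRel.valuation F (a : F)) 1 with h | h
  · exact key a h
  · rw [← inv_inv a]
    refine T.inv_mem (key a⁻¹ ?_)
    change ValuativeRel.valuation F ((a⁻¹ : Fˣ) : F) ≤ 1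
    rw [Units.val_inv_eq_inv_val, map_inv₀]
    exact inv_le_one_of_one_le₀ h

theorem KZ_sup_zpowers_diagUnif (ϖ : 𝒪[F]) (hϖ : Irreducible ϖ) :
    KZ F ⊔ Subgroup.zpowers (diagUnif ϖ hϖ) = ⊤ := by
  have hK : K F ≤ KZ F ⊔ Subgroup.zpowers (diagUnif ϖ hϖ) := le_sup_left.trans le_sup_left
  refine eq_top_of_generators (le_sup_right.trans le_sup_left) (fun a => ?_)
    (hK ⟨upperUnip 1, ?_⟩) (hK ⟨lowerUnip 1, ?_⟩)
  · have := units_eq_top_of_uniformizer hϖ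
      (T := (KZ F ⊔ Subgroup.zpowers (diagUnif ϖ hϖ)).comap (diagHom F)) (fun u => ?_) ?_
    · exact (this ▸ Subgroup.mem_top a : a ∈ _)
    · refine hK ⟨diagHom 𝒪[F] u, ?_⟩
      ext i j
      fin_cases i <;> fin_cases j <;> simp [diagHom]
    · have e : diagHom F (Units.mk0 (ϖ : F) (by simpa using hϖ.ne_zero)) = diagUnif ϖ hϖ :=
        Units.ext rfl
      rw [Subgroup.mem_comap, e]
      exact le_sup_right (a := KZ F) (Subgroup.mem_zpowers (diagUnif ϖ hϖ))
  · ext i j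
    fin_cases i <;> fin_cases j <;> simp [upperUnip]
  · ext i j
    fin_cases i <;> fin_cases j <;> simp [lowerUnip]

variable {k V : Type*} [Field k] [AddCommGroup V] [Module k V]

/-- The orbit of a smooth vector under the compact group `K` is finite. -/
theorem finite_K_orbit (ρ : Representation k (GL (Fin 2) F) V) [IsSmooth ρ] (v : V) :
    {w | ∃ g ∈ K F, w = ρ g v}.Finite := by
  obtain ⟨U, hU, h⟩ := IsSmooth.exists_open (ρ := ρ) v
  let m : GL (Fin 2) 𝒪[F] →* GL (Fin 2) F :=
    Matrix.GeneralLinearGroup.map (n := Fin 2) (algebraMap 𝒪[F] F)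
  have hm : Continuous m := by
    refine Continuous.units_map ((algebraMap 𝒪[F] F).mapMatrix (m := Fin 2)).toMonoidHom ?_
    exact continuous_id.matrix_map continuous_subtype_val
  have : CompactSpace (Matrix (Fin 2) (Fin 2) 𝒪[F]) :=
    inferInstanceAs (CompactSpace (Fin 2 → Fin 2 → 𝒪[F]))
  -- Separation makes the units a closed subset of pairs of matrices, hence compact.
  have : T0Space F :=
    letI := IsTopologicalAddGroup.rightUniformSpace F
    haveI := isUniformAddGroup_of_addCommGroup (G := F)
    inferInstance
  have : T1Space (Matrix (Fin 2) (Fin 2) 𝒪[F]) :=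
    inferInstanceAs (T1Space (Fin 2 → Fin 2 → 𝒪[F]))
  have : CompactSpace (GL (Fin 2) 𝒪[F]) :=
    inferInstanceAs (CompactSpace (Matrix (Fin 2) (Fin 2) 𝒪[F])ˣ)
  have hfin : Finite (GL (Fin 2) 𝒪[F] ⧸ U.comap m) :=
    Subgroup.quotient_finite_of_isOpen _ (hU.preimage hm)
  refine (Set.finite_range fun q : GL (Fin 2) 𝒪[F] ⧸ U.comap m => ρ (m q.out) v).subset ?_
  rintro _ ⟨_, ⟨g, rfl⟩, rfl⟩
  refine ⟨(g : GL (Fin 2) 𝒪[F] ⧸ U.comap m), ?_⟩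
  have hg : m ((g : GL (Fin 2) 𝒪[F] ⧸ U.comap m).out⁻¹ * g) ∈ U :=
    QuotientGroup.eq.1 (QuotientGroup.out_eq' (g : GL (Fin 2) 𝒪[F] ⧸ U.comap m))
  have e := congrArg (ρ (m (g : GL (Fin 2) 𝒪[F] ⧸ U.comap m).out)) (h _ hg)
  rw [← Module.End.mul_apply, ← map_mul, ← map_mul, mul_inv_cancel_left] at e
  exact e.symm

theorem isLocallyFinite_KZ (ρ : Representation k (GL (Fin 2) F) V) [IsSmooth ρ]
    (hZ : HasCentralCharacter ρ) : IsLocallyFinite ρ (KZ F) := by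
  obtain ⟨χ, hχ⟩ := hZ
  intro v
  refine ⟨Submodule.span k {w | ∃ g ∈ K F, w = ρ g v},
    FiniteDimensional.span_of_finite k (finite_K_orbit ρ v), fun h hh => ?_⟩
  obtain ⟨g, hg, z, hz, rfl⟩ := Subgroup.mem_sup_of_normal_right.1 hh
  rw [map_mul, Module.End.mul_apply, hχ ⟨z, hz⟩ v, map_smul]
  exact Submodule.smul_mem _ _ (Submodule.subset_span ⟨g, hg, rfl⟩)

theorem hasCentralCharacter_cIndRep {ρ : Representation k (GL (Fin 2) F) V}
    (hZ : HasCentralCharacter ρ) (W : Subrepresentation (res ρ (KZ F))) :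
    HasCentralCharacter (cIndRep W.toRepresentation) := by
  obtain ⟨χ, hχ⟩ := hZ
  exact ⟨χ, fun z f => cIndRep_center z.2 (le_sup_right (a := K F) z.2)
    (fun v => Subtype.ext (hχ z v)) f⟩

/-- Keeps the "for every `W`" side of the second equivalence from being vacuous. -/
theorem genSubspaces_nonempty (ρ : Representation k (GL (Fin 2) F) V) [IsSmooth ρ]
    (hZ : HasCentralCharacter ρ) (hfg : IsFinGen ρ ⊤) : (genSubspaces ρ).Nonempty := by
  obtain ⟨S, hS, hSV⟩ := hfg
  have : FiniteDimensional k (Submodule.span k S) := FiniteDimensional.span_of_finite k hS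
  obtain ⟨D, hD, h⟩ := (isLocallyFinite_KZ ρ hZ).exists_submodule (Submodule.span k S)
  let W : Subrepresentation (res ρ (KZ F)) :=
    { toSubmodule := Submodule.span k {v | ∃ g ∈ KZ F, ∃ s ∈ S, v = ρ g s}
      apply_mem_toSubmodule := fun a v hv => by
        refine map_mem_span (T := ρ a) ?_ hv
        rintro _ ⟨g, hg, s, hs, rfl⟩
        exact Submodule.subset_span ⟨a * g, (KZ F).mul_mem a.2 hg, s, hs, by simp⟩ }
  refine ⟨W, Submodule.finiteDimensional_of_le (S₂ := D) (Submodule.span_le.2 ?_), ?_⟩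
  · rintro _ ⟨g, hg, s, hs, rfl⟩
    exact h g hg s (Submodule.subset_span hs)
  · rw [eq_top_iff, ← hSV]
    exact gspan_mono fun s hs => Submodule.subset_span ⟨1, (KZ F).one_mem, s, hs, by simp⟩

theorem IsFinitePresentation.of_mem_genSubspaces {ρ : Representation k (GL (Fin 2) F) V}
    [IsSmooth ρ] (hZ : HasCentralCharacter ρ) {W W' : Subrepresentation (res ρ (KZ F))}
    (hW : W ∈ genSubspaces ρ) (hW' : W' ∈ genSubspaces ρ) (h : IsFinitePresentation ρ W) :
    IsFinitePresentation ρ W' := by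
  have := hW.1
  have := hW'.1
  have := isSmooth_cIndRep (isOpen_KZ F) W'.toRepresentation
  exact isFinGen_ker_frobenius (isOpen_KZ F) ρ W W' hW.2 hW'.2
    (isLocallyFinite_KZ _ (hasCentralCharacter_cIndRep hZ W')) h

theorem IsStandardPresentation.isFinitePresentation {ϖ : 𝒪[F]} {hϖ : Irreducible ϖ}
    {ρ : Representation k (GL (Fin 2) F) V} [IsSmooth ρ] {W : Subrepresentation (res ρ (KZ F))}
    (hW : FiniteDimensional k W.toSubmodule) (h : IsStandardPresentation ϖ hϖ ρ W) :
    IsFinitePresentation ρ W := by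
  have := isFinGen_gspan_edgeRelations (α := diagUnif ϖ hϖ) (isOpen_KZ F) ρ W
  -- `elementaryRelations` and `edgeRelations` at `diagUnif ϖ hϖ` agree by definition.
  rwa [IsFinitePresentation, ← h]

theorem AdmitsFinitePresentation.to_standard (ϖ : 𝒪[F]) (hϖ : Irreducible ϖ)
    {ρ : Representation k (GL (Fin 2) F) V} [IsSmooth ρ] (hZ : HasCentralCharacter ρ)
    (h : AdmitsFinitePresentation ρ) : AdmitsStandardPresentation ϖ hϖ ρ := by
  obtain ⟨W, ⟨hW, hWV⟩, hfin⟩ := h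
  obtain ⟨n, hn⟩ := exists_gspan_edgeRelations_eq_ker (isOpen_KZ F) ρ
    (KZ_sup_zpowers_diagUnif ϖ hϖ) W hfin
  refine ⟨ballSpan ρ W (diagUnif ϖ hϖ) n,
    ⟨finiteDimensional_ballSpan (isLocallyFinite_KZ ρ hZ) W n, ?_⟩, hn⟩
  rw [eq_top_iff, ← hWV]
  exact gspan_mono (le_ballSpan ρ W n)

end GL2

end ModPRep

end

theorem mainTheorem9 (p : ℕ) [Fact p.Prime]
    (F : Type*) [Field F] [ValuativeRel F] [TopologicalSpace F] [IsNonarchimedeanLocalField F]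
    [CharP 𝓀[F] p] (ϖ : 𝒪[F]) (hϖ : Irreducible ϖ)
    (k : Type*) [Field k] [IsAlgClosed k] [CharP k p]
    (V : Type*) [AddCommGroup V] [Module k V]
    (ρ : Representation k (GL (Fin 2) F) V) [ModPRep.IsSmooth ρ]
    (hZ : ModPRep.HasCentralCharacter ρ) (hfg : ModPRep.IsFinGen ρ ⊤) :
    (ModPRep.AdmitsFinitePresentation ρ ↔ ModPRep.AdmitsStandardPresentation ϖ hϖ ρ) ∧
    (ModPRep.AdmitsFinitePresentation ρ ↔
      ∀ W ∈ ModPRep.genSubspaces ρ, ModPRep.IsFinitePresentation ρ W) := by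
  refine ⟨⟨fun h => h.to_standard ϖ hϖ hZ, ?_⟩, ?_, fun h => ?_⟩
  · rintro ⟨W, hW, h⟩
    exact ⟨W, hW, h.isFinitePresentation hW.1⟩
  · rintro ⟨W, hW, h⟩ W' hW'
    exact h.of_mem_genSubspaces hZ hW hW'
  · obtain ⟨W, hW⟩ := ModPRep.genSubspaces_nonempty ρ hZ hfg
    exact ⟨W, hW, h W hW⟩
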